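/- Let $f,g:(\mathbb{C}^2,0)\to(\mathbb{C},0)$ be holomorphic germs with Newton--Puiseux factorisations $$f(x,y)=u(x,y)\,y^{E_1}\prod_{i=1}^p\bigl(x-\alpha_i(y)\bigr),\qquad g(x,y)=u'(x,y)\,y^{E_2}\prod_{j=1}^q\bigl(x-\beta_j(y)\bigr),$$ where $E_1,E_2\ge 0$, $u,u'$ are holomorphic units and $\alpha_i,\beta_j$ are (convergent) fractional power series ("arcs") of positive order in $y$. Write $\lambda_1,\dots,\lambda_N$, $N=p+q$, for $\alpha_1,\dots,\alpha_p,\beta_1,\dots,\beta_q$, and assume that they are pairwise distinct. A *polar root* is an arc $\gamma$ of positive order with $J(\gamma(y),y)=0$, where $J=f_yg_x-f_xg_y$, and $f(\gamma(y),y)\,g(\gamma(y),y)\neq 0$. *Tree.* Let $O(\xi,\eta)$ denote the order in $y$ of $\xi-\eta$. Each bar $B$ below has a finite height $h(B)$, a set of roots $\lambda_k$ belonging to it, and an arc $\lambda_B$. The ground bar has height $0$, all the $\lambda_k$ belong to it, and its arc is $0$. Given a bar $B$, its *trunks* are the classes of the roots belonging to it under the relation $O(\lambda_j,\lambda_k)>h(B)$.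 If $T$ is a trunk on $B$ and $h=\min\{O(\lambda_i,\lambda_j):\lambda_i,\lambda_j\in T\}$ is finite, then there is a bar on top of $T$, of height $h$; the roots in $T$ belong to it, and its arc is any root in $T$ with all terms $y^e$, $e\ge h$, omitted. The bars (of finite height) are those obtained in this way from the ground bar. An arc $\xi$ *climbs over $B$ at* $a\in\mathbb{C}$ if $\xi(y)=\lambda_B(y)+a\,y^{h(B)}+(\text{higher order terms})$. Let $T_1,\dots,T_l$ be the trunks on $B$, where the roots in $T_k$ climb over $B$ at $z_k$ and $T_k$ consists of $p_k$ of the $\alpha_i$ and $q_k$ of the $\beta_j$. For $F\in\{f,g\}$ let $\nu_F(B)$ be the order in $y$ of $F(\lambda_B(y)+z\,y^{h(B)},y)$ for generic $z\in\mathbb C$ (for the ground bar: generic small $z$). Put $$\Delta_B(z_k)=\nu_f(B)\,q_k-\nu_g(B)\,p_k,\qquad \mathscr M_B(z)=\sum_{k=1}^l\frac{\Delta_B(z_k)}{z-z_k},$$ where terms with $\Delta_B(z_k)=0$ are omitted. The point $z_k$ is *collinear* if $\Delta_B(z_k)=0$, and *non-collinear* otherwise. Let $C(B)$ and $N(B)$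 be the sets of collinear and of non-collinear points on $B$, and let $M(B)$ be the set of *mero-zeros*, i.e. of $z\in\mathbb{C}\setminus N(B)$ with $\mathscr M_B(z)=0$. **Statement.** Let $B$ be a bar of finite height. If a polar root climbs over $B$ at $z$, then $z\in N(B)\cup C(B)\cup M(B)$. (This applies in particular to every non-collinear bar, i.e. every bar with $N(B)\neq\emptyset$; if $N(B)=\emptyset$, then $M(B)=\mathbb{C}$.) -/

import Mathlib

open Filter Topology

noncomputable section

namespace PolarTree

/-! ### Fractional power series -/

/-- All exponents of `ξ` are of the form `n / d` with `n` a natural number. -/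
def HasDen (ξ : HahnSeries ℚ ℂ) (d : ℕ) : Prop :=
  0 < d ∧ ∀ e ∈ ξ.support, ∃ n : ℕ, e = (n : ℚ) / (d : ℚ)

/-- A (convergent) fractional power series, or "arc": `ξ(y) = ∑ cₙ y^(n/d)`, where `∑ cₙ tⁿ` has
positive radius of convergence. -/
def IsArc (ξ : HahnSeries ℚ ℂ) : Prop :=
  ∃ d : ℕ, HasDen ξ d ∧
    ∃ r : ℝ, 0 < r ∧ Summable fun n : ℕ => ‖ξ.coeff ((n : ℚ) / (d : ℚ))‖ * r ^ n

/-- The value `ξ(t ^ d)`, that is, the function obtained from `ξ(y)` by putting `y = t ^ d`;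
meaningful when `HasDen ξ d` and `t` is small. -/
def param (ξ : HahnSeries ℚ ℂ) (d : ℕ) (t : ℂ) : ℂ :=
  ∑' n : ℕ, ξ.coeff ((n : ℚ) / (d : ℚ)) * t ^ n

/-- The contact order `O_y(ξ(y) - η(y))`, equal to `⊤` when `ξ = η`. -/
def contact (ξ η : HahnSeries ℚ ℂ) : WithTop ℚ := (ξ - η).orderTop

/-- `F(ξ(y), y) = 0`, identically in `y` near `0`. -/
def VanishesAlong (F : ℂ × ℂ → ℂ) (ξ : HahnSeries ℚ ℂ) : Prop :=
  ∃ d : ℕ, HasDen ξ d ∧ ∀ᶠ t in 𝓝 (0 : ℂ), F (param ξ d t, t ^ d) = 0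

/-- `O_y(F(ξ(y), y)) = v`: after `y = t ^ d`, the order in `t` is `n` and `v = n / d`. -/
def HasOrderAlong (F : ℂ × ℂ → ℂ) (ξ : HahnSeries ℚ ℂ) (v : ℚ) : Prop :=
  ∃ d : ℕ, HasDen ξ d ∧ ∃ n : ℕ,
    analyticOrderAt (fun t : ℂ => F (param ξ d t, t ^ d)) 0 = (n : ℕ∞) ∧ v = (n : ℚ) / (d : ℚ)

/-! ### Newton-Puiseux factorisations and polar roots -/

/-- Near the origin, `F(x, y) = u(x, y) * y ^ E * ∏ i, (x - α i (y))`, where `u` is a holomorphic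
unit and the `α i` are fractional power series of positive order. -/
def IsNewtonPuiseux (F : ℂ × ℂ → ℂ) (E : ℕ) {n : ℕ} (α : Fin n → HahnSeries ℚ ℂ) : Prop :=
  (∀ i, IsArc (α i) ∧ 0 < (α i).orderTop) ∧
  ∃ u : ℂ × ℂ → ℂ, AnalyticAt ℂ u (0, 0) ∧ u (0, 0) ≠ 0 ∧
    ∃ d : ℕ, 0 < d ∧ (∀ i, HasDen (α i) d) ∧
      ∀ᶠ w : ℂ × ℂ in 𝓝 (0, 0),
        F (w.1, w.2 ^ d) =
          u (w.1, w.2 ^ d) * (w.2 ^ d) ^ E * ∏ i, (w.1 - param (α i) d w.2)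

/-- The Jacobian determinant `J = f_y g_x - f_x g_y`. -/
def jac (f g : ℂ × ℂ → ℂ) (w : ℂ × ℂ) : ℂ :=
  deriv (fun y => f (w.1, y)) w.2 * deriv (fun x => g (x, w.2)) w.1
    - deriv (fun x => f (x, w.2)) w.1 * deriv (fun y => g (w.1, y)) w.2

/-- A polar root of `(f, g)`: an arc `γ` of positive order with `J(γ(y), y) = 0` and
`f(γ(y), y) g(γ(y), y) ≠ 0`. -/
def IsPolarRoot (f g : ℂ × ℂ → ℂ) (γ : HahnSeries ℚ ℂ) : Prop :=
  IsArc γ ∧ 0 < γ.orderTop ∧ VanishesAlong (jac f g) γ ∧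
    ¬ VanishesAlong (fun w => f w * g w) γ

/-! ### The tree model

The roots are `α i` (`i : Fin p`) and `β j` (`j : Fin q`), together written as
`root α β k` with `k : Fin p ⊕ Fin q`. -/

/-- The family `λ_k` of all roots `α i`, `β j`. -/
def root {p q : ℕ} (α : Fin p → HahnSeries ℚ ℂ) (β : Fin q → HahnSeries ℚ ℂ) :
    Fin p ⊕ Fin q → HahnSeries ℚ ℂ :=
  Sum.elim α β

/-- A bar of finite height, recorded by its height `h(B)`, the arc `λ_B`, and the set of (indices
of) roots in the trunk below it. -/
structure Bar (p q : ℕ) where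
  height : ℚ
  base : HahnSeries ℚ ℂ
  roots : Finset (Fin p ⊕ Fin q)

open Classical in
/-- The trunk on `B` which contains the root with index `k`: its class modulo `h(B)⁺`. -/
def trunk {p q : ℕ} (α : Fin p → HahnSeries ℚ ℂ) (β : Fin q → HahnSeries ℚ ℂ)
    (B : Bar p q) (k : Fin p ⊕ Fin q) : Finset (Fin p ⊕ Fin q) :=
  B.roots.filter fun j => (B.height : WithTop ℚ) < contact (root α β j) (root α β k)

/-- The bars of finite height of the tree `T(f, g)`. The ground bar has height `0` and `λ_B = 0`.
If the trunk on `B` containing `k` has smallest contact order `h < ∞`, it carries on top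
a bar of height `h`, and `λ_B` of that bar is the root `k` with all terms `y ^ e`, `e ≥ h`,
omitted. -/
inductive IsBar {p q : ℕ} (α : Fin p → HahnSeries ℚ ℂ) (β : Fin q → HahnSeries ℚ ℂ) :
    Bar p q → Prop
  | ground : IsBar α β ⟨0, 0, Finset.univ⟩
  | postbar (B : Bar p q) (k : Fin p ⊕ Fin q) (h : ℚ) :
      IsBar α β B → k ∈ B.roots →
      IsLeast {o : WithTop ℚ | ∃ i ∈ trunk α β B k, ∃ j ∈ trunk α β B k,
        o = contact (root α β i) (root α β j)} (h : WithTop ℚ) →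
      IsBar α β ⟨h, HahnSeries.truncLT h (root α β k), trunk α β B k⟩

/-- The arc `λ_B(y) + z y ^ h(B)`. -/
def arcAt {p q : ℕ} (B : Bar p q) (z : ℂ) : HahnSeries ℚ ℂ :=
  B.base + HahnSeries.single B.height z

/-- `ξ` climbs over `B` at `a`: `ξ(y) = λ_B(y) + a y ^ h(B) + ⋯`. -/
def ClimbsAt {p q : ℕ} (ξ : HahnSeries ℚ ℂ) (B : Bar p q) (a : ℂ) : Prop :=
  (B.height : WithTop ℚ) < (ξ - arcAt B a).orderTop

open Classical in
/-- The generic order `ν_F(B) = O_y(F(λ_B(y) + z y ^ h(B), y))`, `z` generic. If `h(B) > 0`, the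
order is the same for all but finitely many `z`; for the ground bar, where the germ `F(z, y)` makes
sense only for small `z`, it is the same for all small `z ≠ 0`. So in both cases it is the order
for all `z ≠ 0` close to `0`. -/
def nu {p q : ℕ} (F : ℂ × ℂ → ℂ) (B : Bar p q) : ℚ :=
  if h : ∃ v : ℚ, ∀ᶠ z in 𝓝[≠] (0 : ℂ), HasOrderAlong F (arcAt B z) v then h.choose else 0

open Classical in
/-- The points `z_1, …, z_l` at which the trunks on `B` grow: `λ_k = λ_B + c y ^ h(B) + ⋯` for a
root `λ_k` on `B` grows at `c`, its coefficient at `y ^ h(B)`. -/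
def points {p q : ℕ} (α : Fin p → HahnSeries ℚ ℂ) (β : Fin q → HahnSeries ℚ ℂ)
    (B : Bar p q) : Finset ℂ :=
  B.roots.image fun k => (root α β k).coeff B.height

open Classical in
/-- First component of the bimultiplicity of `c` on `B`: the number of `α i` in the trunk on `B`
that grows at `c`. -/
def multF {p q : ℕ} (α : Fin p → HahnSeries ℚ ℂ) (B : Bar p q) (c : ℂ) : ℕ :=
  (Finset.univ.filter fun i : Fin p => Sum.inl i ∈ B.roots ∧ ClimbsAt (α i) B c).card

open Classical in
/-- Second component of the bimultiplicity of `c` on `B`: the number of `β j` in the trunk on `B`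
that grows at `c`. -/
def multG {p q : ℕ} (β : Fin q → HahnSeries ℚ ℂ) (B : Bar p q) (c : ℂ) : ℕ :=
  (Finset.univ.filter fun j : Fin q => Sum.inr j ∈ B.roots ∧ ClimbsAt (β j) B c).card

/-- `Δ_B(c) = ν_f(B) q_c - ν_g(B) p_c`, where `[p_c, q_c]` is the bimultiplicity of `c`. -/
def delta {p q : ℕ} (f g : ℂ × ℂ → ℂ) (α : Fin p → HahnSeries ℚ ℂ)
    (β : Fin q → HahnSeries ℚ ℂ) (B : Bar p q) (c : ℂ) : ℚ :=
  nu f B * multG β B c - nu g B * multF α B c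

/-- The rational function `M_B(z) = ∑ Δ_B(z_k) / (z - z_k)` associated to `B`. The terms with
`Δ_B(z_k) = 0` are `0`; at a point with `Δ_B(z_k) ≠ 0` the function has a pole and this value is
not meaningful. -/
def meroFun {p q : ℕ} (f g : ℂ × ℂ → ℂ) (α : Fin p → HahnSeries ℚ ℂ)
    (β : Fin q → HahnSeries ℚ ℂ) (B : Bar p q) (z : ℂ) : ℂ :=
  ∑ c ∈ points α β B, (delta f g α β B c : ℂ) / (z - c)

/-- `C(B)`: the collinear points on `B`. -/
def collinearPts {p q : ℕ} (f g : ℂ × ℂ → ℂ) (α : Fin p → HahnSeries ℚ ℂ)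
    (β : Fin q → HahnSeries ℚ ℂ) (B : Bar p q) : Set ℂ :=
  {c | c ∈ points α β B ∧ delta f g α β B c = 0}

/-- `N(B)`: the non-collinear points on `B`. -/
def nonCollinearPts {p q : ℕ} (f g : ℂ × ℂ → ℂ) (α : Fin p → HahnSeries ℚ ℂ)
    (β : Fin q → HahnSeries ℚ ℂ) (B : Bar p q) : Set ℂ :=
  {c | c ∈ points α β B ∧ delta f g α β B c ≠ 0}

/-- `M(B)`: the mero-zeros on `B`, i.e. the zeros of `M_B` (which are not poles). -/
def meroZeros {p q : ℕ} (f g : ℂ × ℂ → ℂ) (α : Fin p → HahnSeries ℚ ℂ)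
    (β : Fin q → HahnSeries ℚ ℂ) (B : Bar p q) : Set ℂ :=
  {z | z ∉ nonCollinearPts f g α β B ∧ meroFun f g α β B z = 0}

end PolarTree

end

namespace PolarTree

/-! ### Convergent power series in one variable -/

/-! If `z` is one of the points on `B`, it is collinear or non-collinear according to `delta`. The
content is the case where `z` is not such a point, so that the polar root γ leaves every root on `B`
exactly at height h = h(B).

By the ultrametric inequality, γ then has the same contact orders with all roots as a generic arc
λ_B + a y^h (`IsBar.exists_contact_eq`). Hence f and g have orders ν_f(B) and ν_g(B) along γ
(`FactorsWith.order_along`, `FactorsWith.nu_eq`).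

Put y = t^D and h = H/D. By the chain rule, J = 0 along γ gives (f∘γ)' g_x = (g∘γ)' f_x
(`eventually_deriv_mul_eq`). Multiply by t^(H+1), divide by fg, and let t → 0. The factor t
(f∘γ)'/(f∘γ) tends to D ν_f(B) (`tendsto_mul_logDeriv`). In t^H g_x/g only the roots with contact
exactly h survive, so the limit is ∑ q_k/(z - z_k) (`FactorsWith.tendsto_logDeriv`, `sum_mult_div`).
The same holds with f and g exchanged. Equating the limits gives ν_f ∑ q_k/(z - z_k) = ν_g ∑ p_k/(z
- z_k), which is M_B(z) = 0.

This needs h > 0. On the ground bar, positivity of all orders forces z = 0, which is a point as soon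
as there is a root. -/

lemma norm_term_le_geometric {a : ℕ → ℂ} {r C : ℝ}
    (h : ∀ n, ‖a n‖ * r ^ n ≤ C) {t : ℂ} (ht : ‖t‖ < r / 2) (n : ℕ) :
    ‖a n * t ^ n‖ ≤ C * (1 / 2) ^ n := by
  rw [norm_mul, norm_pow]
  calc ‖a n‖ * ‖t‖ ^ n ≤ ‖a n‖ * (r / 2) ^ n := by gcongr
    _ = ‖a n‖ * r ^ n * (1 / 2) ^ n := by rw [div_pow, div_pow, one_pow]; ring
    _ ≤ C * (1 / 2) ^ n := by gcongr; exact h n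

lemma summable_const_mul_geometric (C : ℝ) : Summable fun n : ℕ => C * (1 / 2 : ℝ) ^ n :=
  summable_geometric_two.mul_left C

lemma summable_powerSeries {a : ℕ → ℂ} {r C : ℝ}
    (h : ∀ n, ‖a n‖ * r ^ n ≤ C) {t : ℂ} (ht : ‖t‖ < r / 2) :
    Summable fun n => a n * t ^ n :=
  Summable.of_norm_bounded (summable_const_mul_geometric C)
    (norm_term_le_geometric h ht)

/-- On the disc of radius `r / 2` a geometric series dominates, so the sum is holomorphic by
Weierstrass. A bound on `‖a n‖ * r ^ n` is easier to carry through sums and truncations than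
summability. -/
lemma analyticAt_tsum_powerSeries {a : ℕ → ℂ} {r C : ℝ} (hr : 0 < r)
    (h : ∀ n, ‖a n‖ * r ^ n ≤ C) : AnalyticAt ℂ (fun t => ∑' n, a n * t ^ n) 0 := by
  have hd : DifferentiableOn ℂ (fun t => ∑' n, a n * t ^ n) (Metric.ball 0 (r / 2)) := by
    refine Complex.differentiableOn_tsum_of_summable_norm (summable_const_mul_geometric C)
      (fun n => ?_) Metric.isOpen_ball fun n w hw => ?_
    · fun_prop
    · exact norm_term_le_geometric h (by simpa using hw) n
  exact hd.analyticAt (Metric.isOpen_ball.mem_nhds (by simpa using hr))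

/-! ### Coefficients and orders -/

lemma lt_orderTop_iff {x : HahnSeries ℚ ℂ} {h : ℚ} :
    (h : WithTop ℚ) < x.orderTop ↔ ∀ e ≤ h, x.coeff e = 0 := by
  refine ⟨fun hx e he => HahnSeries.coeff_eq_zero_of_lt_orderTop
    (lt_of_le_of_lt (WithTop.coe_le_coe.2 he) hx), fun hx => ?_⟩
  by_contra hlt
  rcases ho : x.orderTop with _ | o
  · exact hlt (by rw [ho]; exact WithTop.coe_lt_top h)
  · refine HahnSeries.coeff_orderTop_ne (x := x) (g := o) ho (hx o ?_)
    rw [ho] at hlt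
    exact WithTop.coe_le_coe.1 (not_lt.1 hlt)

lemma le_orderTop_iff {x : HahnSeries ℚ ℂ} {h : ℚ} :
    (h : WithTop ℚ) ≤ x.orderTop ↔ ∀ e < h, x.coeff e = 0 := by
  refine ⟨fun hx e he => HahnSeries.coeff_eq_zero_of_lt_orderTop
    (lt_of_lt_of_le (WithTop.coe_lt_coe.2 he) hx), fun hx => ?_⟩
  by_contra hlt
  rcases ho : x.orderTop with _ | o
  · exact hlt (by rw [ho]; exact le_top)
  · refine HahnSeries.coeff_orderTop_ne (x := x) (g := o) ho (hx o ?_)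
    rw [ho] at hlt
    exact WithTop.coe_lt_coe.1 (not_le.1 hlt)

lemma contact_comm (ξ η : HahnSeries ℚ ℂ) : contact ξ η = contact η ξ := by
  rw [contact, contact, ← HahnSeries.orderTop_neg, neg_sub]

/-! ### Denominators and convergence -/

/-- `ξ` has denominator `d`, and `∑ cₙ tⁿ` with `cₙ` the coefficient of `ξ` at `n / d` converges
near `0`. -/
def ConvergesWith (ξ : HahnSeries ℚ ℂ) (d : ℕ) : Prop :=
  HasDen ξ d ∧ ∃ r : ℝ, 0 < r ∧ ∃ C : ℝ, ∀ n : ℕ, ‖ξ.coeff ((n : ℚ) / (d : ℚ))‖ * r ^ n ≤ C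

lemma HasDen.mul {ξ : HahnSeries ℚ ℂ} {d m : ℕ} (h : HasDen ξ d) (hm : 0 < m) :
    HasDen ξ (d * m) := by
  refine ⟨Nat.mul_pos h.1 hm, fun e he => ?_⟩
  obtain ⟨n, rfl⟩ := h.2 e he
  refine ⟨n * m, ?_⟩
  have : (m : ℚ) ≠ 0 := by positivity
  push_cast
  rw [mul_div_mul_right _ _ this]

lemma HasDen.sub {ξ η : HahnSeries ℚ ℂ} {d : ℕ} (h : HasDen ξ d) (h' : HasDen η d) :
    HasDen (ξ - η) d := by
  refine ⟨h.1, fun e he => ?_⟩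
  by_cases h1 : ξ.coeff e = 0
  · by_cases h2 : η.coeff e = 0
    · simp [h1, h2] at he
    · exact h'.2 e h2
  · exact h.2 e h1

lemma HasDen.add {ξ η : HahnSeries ℚ ℂ} {d : ℕ} (h : HasDen ξ d) (h' : HasDen η d) :
    HasDen (ξ + η) d := by
  refine ⟨h.1, fun e he => ?_⟩
  by_cases h1 : ξ.coeff e = 0
  · by_cases h2 : η.coeff e = 0
    · simp [h1, h2] at he
    · exact h'.2 e h2
  · exact h.2 e h1

/-- A finite order of a series with denominator `d` is of the form `n / d`. -/
lemma HasDen.orderTop_eq {ξ : HahnSeries ℚ ℂ} {d : ℕ} (h : HasDen ξ d) (hξ : ξ ≠ 0) :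
    ∃ n : ℕ, ξ.orderTop = (((n : ℚ) / (d : ℚ) : ℚ) : WithTop ℚ) := by
  rcases ho : ξ.orderTop with _ | o
  · exact absurd (HahnSeries.orderTop_eq_top.1 ho) hξ
  · obtain ⟨n, hn⟩ := h.2 o (HahnSeries.coeff_orderTop_ne ho)
    exact ⟨n, congrArg _ hn⟩

lemma bound_shrink {c r s C : ℝ} (hc : 0 ≤ c) (hs : 0 ≤ s) (hsr : s ≤ r) {n : ℕ}
    (h : c * r ^ n ≤ C) : c * s ^ n ≤ C :=
  le_trans (by gcongr) h

/-- Convergence does not depend on the denominator. -/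
lemma ConvergesWith.change {ξ : HahnSeries ℚ ℂ} {d D : ℕ} (h : ConvergesWith ξ d)
    (hD : HasDen ξ D) : ConvergesWith ξ D := by
  obtain ⟨hd, r, hr, C, hC⟩ := h
  -- A nonzero coefficient at n/D = k/d has d n = k D. With s = min r 1 this gives (s^d)^n = s^(kD)
  -- ≤ s^k ≤ r^k, where s ≤ 1 is used.
  refine ⟨hD, min r 1 ^ d, by positivity, C, fun n => ?_⟩
  have hC0 : 0 ≤ C := le_trans (by positivity) (hC 0)
  by_cases h0 : ξ.coeff ((n : ℚ) / (D : ℚ)) = 0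
  · simpa [h0] using hC0
  obtain ⟨k, hk⟩ := hd.2 _ h0
  have hdpos := hd.1
  have hDpos := hD.1
  have hnk : d * n = k * D := by
    have h1 : (D : ℚ) ≠ 0 := by positivity
    have h2 : (d : ℚ) ≠ 0 := by positivity
    rw [div_eq_div_iff h1 h2] at hk
    rw [mul_comm]
    exact_mod_cast hk
  rw [← pow_mul, hnk, hk]
  refine le_trans ?_ (hC k)
  gcongr
  calc min r 1 ^ (k * D) ≤ min r 1 ^ k :=
        pow_le_pow_of_le_one (by positivity) (min_le_right _ _) (Nat.le_mul_of_pos_right _ hDpos)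
    _ ≤ r ^ k := by gcongr; exact min_le_left _ _

lemma IsArc.convergesWith {ξ : HahnSeries ℚ ℂ} (h : IsArc ξ) {D : ℕ} (hD : HasDen ξ D) :
    ConvergesWith ξ D := by
  obtain ⟨d, hd, r, hr, hs⟩ := h
  refine ConvergesWith.change (d := d) ⟨hd, r, hr,
    ∑' n : ℕ, ‖ξ.coeff ((n : ℚ) / (d : ℚ))‖ * r ^ n, fun n => ?_⟩ hD
  exact hs.le_tsum n fun _ _ => by positivity

lemma ConvergesWith.sub {ξ η : HahnSeries ℚ ℂ} {d : ℕ} (h : ConvergesWith ξ d)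
    (h' : ConvergesWith η d) : ConvergesWith (ξ - η) d := by
  obtain ⟨hd, r, hr, C, hC⟩ := h
  obtain ⟨hd', r', hr', C', hC'⟩ := h'
  refine ⟨hd.sub hd', min r r', by positivity, C + C', fun n => ?_⟩
  have h1 := bound_shrink (norm_nonneg _) (by positivity) (min_le_left r r') (hC n)
  have h2 := bound_shrink (norm_nonneg _) (by positivity) (min_le_right r r') (hC' n)
  refine le_trans ?_ (add_le_add h1 h2)
  rw [← add_mul, HahnSeries.coeff_sub]
  gcongr
  exact norm_sub_le _ _

lemma ConvergesWith.add {ξ η : HahnSeries ℚ ℂ} {d : ℕ} (h : ConvergesWith ξ d)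
    (h' : ConvergesWith η d) : ConvergesWith (ξ + η) d := by
  obtain ⟨hd, r, hr, C, hC⟩ := h
  obtain ⟨hd', r', hr', C', hC'⟩ := h'
  refine ⟨hd.add hd', min r r', by positivity, C + C', fun n => ?_⟩
  have h1 := bound_shrink (norm_nonneg _) (by positivity) (min_le_left r r') (hC n)
  have h2 := bound_shrink (norm_nonneg _) (by positivity) (min_le_right r r') (hC' n)
  refine le_trans ?_ (add_le_add h1 h2)
  rw [← add_mul, HahnSeries.coeff_add]
  gcongr
  exact norm_add_le _ _

lemma ConvergesWith.truncLT {ξ : HahnSeries ℚ ℂ} {d : ℕ} (h : ConvergesWith ξ d) (c : ℚ) :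
    ConvergesWith (HahnSeries.truncLT c ξ) d := by
  obtain ⟨hd, r, hr, C, hC⟩ := h
  refine ⟨⟨hd.1, fun e he => hd.2 e (HahnSeries.support_truncLT_subset _ _ he)⟩,
    r, hr, C, fun n => ?_⟩
  rw [HahnSeries.coeff_truncLT]
  split_ifs
  · exact hC n
  · simpa using le_trans (by positivity) (hC n)

lemma convergesWith_single {d : ℕ} (hd : 0 < d) (n : ℕ) (z : ℂ) :
    ConvergesWith (HahnSeries.single ((n : ℚ) / (d : ℚ)) z) d := by
  refine ⟨⟨hd, fun e he => ⟨n, HahnSeries.support_single_subset he⟩⟩, 1, one_pos, ‖z‖,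
    fun m => ?_⟩
  rw [one_pow, mul_one, HahnSeries.coeff_single]
  split_ifs <;> simp

/-! ### Parametrisations -/

lemma ConvergesWith.analyticAt_param {ξ : HahnSeries ℚ ℂ} {d : ℕ} (h : ConvergesWith ξ d) :
    AnalyticAt ℂ (param ξ d) 0 := by
  obtain ⟨-, r, hr, C, hC⟩ := h
  exact analyticAt_tsum_powerSeries hr hC

lemma param_zero (ξ : HahnSeries ℚ ℂ) (d : ℕ) : param ξ d 0 = ξ.coeff 0 := by
  rw [param, tsum_eq_single 0]
  · simp
  · intro n hn
    simp [hn]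

lemma param_zero_of_pos {ξ : HahnSeries ℚ ℂ} (h : 0 < ξ.orderTop) (d : ℕ) :
    param ξ d 0 = 0 := by
  rw [param_zero]
  exact HahnSeries.coeff_eq_zero_of_lt_orderTop h

/-- With denominator `d`, only multiples of `m` index nonzero coefficients over the denominator `d *
m`. -/
lemma param_mul {ξ : HahnSeries ℚ ℂ} {d m : ℕ} (h : HasDen ξ d) (hm : 0 < m) (t : ℂ) :
    param ξ (d * m) t = param ξ d (t ^ m) := by
  have hm' : (m : ℚ) ≠ 0 := by positivity
  have hd : (d : ℚ) ≠ 0 := by have := h.1; positivity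
  have hinj : Function.Injective fun k : ℕ => k * m := fun a b hab =>
    Nat.eq_of_mul_eq_mul_right hm hab
  rw [param, param, ← hinj.tsum_eq]
  · refine tsum_congr fun k => ?_
    push_cast
    rw [mul_div_mul_right _ _ hm', mul_comm k m, pow_mul]
  · intro n hn
    have hn' : ξ.coeff ((n : ℚ) / ((d * m : ℕ) : ℚ)) ≠ 0 := fun h0 => hn (by simp only [h0, zero_mul])
    obtain ⟨k, hk⟩ := h.2 _ hn'
    refine ⟨k, ?_⟩
    push_cast at hk
    field_simp at hk
    rw [mul_comm] at hk
    exact_mod_cast hk.symm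

lemma eventually_param_sub {ξ η : HahnSeries ℚ ℂ} {d : ℕ} (h : ConvergesWith ξ d)
    (h' : ConvergesWith η d) :
    ∀ᶠ t in 𝓝 (0 : ℂ), param (ξ - η) d t = param ξ d t - param η d t := by
  obtain ⟨-, r, hr, C, hC⟩ := h
  obtain ⟨-, r', hr', C', hC'⟩ := h'
  filter_upwards [Metric.ball_mem_nhds (0 : ℂ) (half_pos hr),
    Metric.ball_mem_nhds (0 : ℂ) (half_pos hr')] with t ht ht'
  rw [param, param, param, ← Summable.tsum_sub
    (summable_powerSeries hC (by simpa using ht))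
    (summable_powerSeries hC' (by simpa using ht'))]
  exact tsum_congr fun n => by rw [HahnSeries.coeff_sub, sub_mul]

/-- If the order of `ξ` is at least `n / d`, then `ξ(t ^ d) = t ^ n * Q t`, where `Q 0` is the
coefficient of `ξ` at `n / d`. -/
lemma ConvergesWith.exists_factor {ξ : HahnSeries ℚ ℂ} {d : ℕ} (h : ConvergesWith ξ d) {n : ℕ}
    (hn : (((n : ℚ) / (d : ℚ) : ℚ) : WithTop ℚ) ≤ ξ.orderTop) :
    ∃ Q : ℂ → ℂ, AnalyticAt ℂ Q 0 ∧ Q 0 = ξ.coeff ((n : ℚ) / (d : ℚ)) ∧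
      ∀ᶠ t in 𝓝 (0 : ℂ), param ξ d t = t ^ n * Q t := by
  obtain ⟨hd, r, hr, C, hC⟩ := h
  have hdpos := hd.1
  have hC' : ∀ k : ℕ, ‖ξ.coeff (((k + n : ℕ) : ℚ) / (d : ℚ))‖ * r ^ k ≤ C / r ^ n := fun k => by
    rw [le_div_iff₀ (by positivity), mul_assoc, ← pow_add]
    exact hC (k + n)
  refine ⟨fun t => ∑' k : ℕ, ξ.coeff (((k + n : ℕ) : ℚ) / (d : ℚ)) * t ^ k,
    analyticAt_tsum_powerSeries hr hC', ?_, ?_⟩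
  · change ∑' k : ℕ, ξ.coeff (((k + n : ℕ) : ℚ) / (d : ℚ)) * 0 ^ k = _
    rw [tsum_eq_single 0]
    · simp
    · intro k hk
      simp [hk]
  · filter_upwards [Metric.ball_mem_nhds (0 : ℂ) (half_pos hr)] with t ht
    have hs := summable_powerSeries hC (t := t) (by simpa using ht)
    rw [param, ← hs.sum_add_tsum_nat_add n, Finset.sum_eq_zero, zero_add, ← tsum_mul_left]
    · exact tsum_congr fun k => by rw [pow_add]; ring
    · intro k hk
      rw [le_orderTop_iff.1 hn, zero_mul]
      have : (k : ℚ) < n := by exact_mod_cast Finset.mem_range.1 hk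
      gcongr

/-! ### Functions along an arc -/

lemma ConvergesWith.analyticAt_curve {ξ : HahnSeries ℚ ℂ} {d : ℕ} (h : ConvergesWith ξ d) :
    AnalyticAt ℂ (fun t : ℂ => (param ξ d t, t ^ d)) 0 :=
  h.analyticAt_param.prod (analyticAt_id.pow d)

lemma curve_zero {ξ : HahnSeries ℚ ℂ} {d : ℕ} (hd : 0 < d) (hξ : 0 < ξ.orderTop) :
    (param ξ d 0, (0 : ℂ) ^ d) = (0, 0) := by
  rw [param_zero_of_pos hξ, zero_pow hd.ne']

lemma ConvergesWith.tendsto_curve {ξ : HahnSeries ℚ ℂ} {d : ℕ} (h : ConvergesWith ξ d)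
    (hξ : 0 < ξ.orderTop) :
    Tendsto (fun t : ℂ => (param ξ d t, t ^ d)) (𝓝 0) (𝓝 (0, 0)) := by
  have := h.analyticAt_curve.continuousAt.tendsto
  rwa [curve_zero h.1.1 hξ] at this

lemma ConvergesWith.analyticAt_comp {ξ : HahnSeries ℚ ℂ} {d : ℕ} (h : ConvergesWith ξ d)
    (hξ : 0 < ξ.orderTop) {F : ℂ × ℂ → ℂ} (hF : AnalyticAt ℂ F (0, 0)) :
    AnalyticAt ℂ (fun t : ℂ => F (param ξ d t, t ^ d)) 0 := by
  rw [← curve_zero h.1.1 hξ] at hF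
  exact AnalyticAt.comp (g := F) hF h.analyticAt_curve

/-- Passing from the denominator `d` to `d * m` multiplies the order in `t` by `m`. -/
lemma order_comp_pow {ξ : HahnSeries ℚ ℂ} {d m : ℕ} (h : ConvergesWith ξ d)
    (hξ : 0 < ξ.orderTop) {F : ℂ × ℂ → ℂ} (hF : AnalyticAt ℂ F (0, 0)) (hm : 0 < m) {n : ℕ}
    (hn : analyticOrderAt (fun t : ℂ => F (param ξ d t, t ^ d)) 0 = n) :
    analyticOrderAt (fun t : ℂ => F (param ξ (d * m) t, t ^ (d * m))) 0 = (n * m : ℕ) := by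
  have h' : ConvergesWith ξ (d * m) := h.change (h.1.mul hm)
  rw [(h.analyticAt_comp hξ hF).analyticOrderAt_eq_natCast] at hn
  rw [(h'.analyticAt_comp hξ hF).analyticOrderAt_eq_natCast]
  obtain ⟨q, hq, hq0, hqe⟩ := hn
  have hpow : Tendsto (fun t : ℂ => t ^ m) (𝓝 0) (𝓝 0) := by
    have := (continuous_pow m).tendsto (0 : ℂ)
    rwa [zero_pow hm.ne'] at this
  refine ⟨fun t => q (t ^ m), ?_, by simpa [zero_pow hm.ne'] using hq0, ?_⟩
  · refine AnalyticAt.comp (g := q) ?_ (analyticAt_id.pow m)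
    simpa [zero_pow hm.ne'] using hq
  · filter_upwards [hpow.eventually hqe] with t ht
    simp only [sub_zero] at ht ⊢
    rw [param_mul h.1 hm, mul_comm d m, pow_mul, ht, ← pow_mul, mul_comm m n]

/-- The two denominators are compared over their product. This makes the value chosen in `nu` well
defined. -/
lemma HasOrderAlong.unique {ξ : HahnSeries ℚ ℂ} {d₀ : ℕ} (h : ConvergesWith ξ d₀)
    (hξ : 0 < ξ.orderTop) {F : ℂ × ℂ → ℂ} (hF : AnalyticAt ℂ F (0, 0)) {v v' : ℚ}
    (hv : HasOrderAlong F ξ v) (hv' : HasOrderAlong F ξ v') : v = v' := by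
  obtain ⟨d, hd, n, hn, rfl⟩ := hv
  obtain ⟨d', hd', n', hn', rfl⟩ := hv'
  have e := order_comp_pow (h.change hd) hξ hF hd'.1 hn
  have e' := order_comp_pow (h.change hd') hξ hF hd.1 hn'
  rw [mul_comm d' d, e] at e'
  have e2 : n * d' = n' * d := by exact_mod_cast e'
  have h1 : (d : ℚ) ≠ 0 := by have := hd.1; positivity
  have h2 : (d' : ℚ) ≠ 0 := by have := hd'.1; positivity
  rw [div_eq_div_iff h1 h2]
  exact_mod_cast e2

lemma eventually_vanishes_mul {F : ℂ × ℂ → ℂ} {ξ : HahnSeries ℚ ℂ} {d m : ℕ}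
    (h : HasDen ξ d) (hm : 0 < m) (hF : ∀ᶠ t in 𝓝 (0 : ℂ), F (param ξ d t, t ^ d) = 0) :
    ∀ᶠ t in 𝓝 (0 : ℂ), F (param ξ (d * m) t, t ^ (d * m)) = 0 := by
  have hpow : Tendsto (fun t : ℂ => t ^ m) (𝓝 0) (𝓝 0) := by
    have := (continuous_pow m).tendsto (0 : ℂ)
    rwa [zero_pow hm.ne'] at this
  filter_upwards [hpow.eventually hF] with t ht
  rwa [param_mul h hm, mul_comm d m, pow_mul]

/-! ### Factorisations with a given denominator -/

/-- The Newton-Puiseux factorisation of `F` after `y = t ^ D`, with unit `u`. -/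
structure FactorsWith (F u : ℂ × ℂ → ℂ) (E : ℕ) {n : ℕ} (α : Fin n → HahnSeries ℚ ℂ)
    (D : ℕ) : Prop where
  conv : ∀ i, ConvergesWith (α i) D
  pos : ∀ i, 0 < (α i).orderTop
  analyticAt : AnalyticAt ℂ u (0, 0)
  ne_zero : u (0, 0) ≠ 0
  eq : ∀ᶠ w : ℂ × ℂ in 𝓝 (0, 0),
    F (w.1, w.2 ^ D) = u (w.1, w.2 ^ D) * (w.2 ^ D) ^ E * ∏ i, (w.1 - param (α i) D w.2)

/-- All multiples of `d` are allowed, with the same unit, so that f, g and the polar root can share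
one denominator. -/
lemma IsNewtonPuiseux.exists_factorsWith {F : ℂ × ℂ → ℂ} {E n : ℕ}
    {α : Fin n → HahnSeries ℚ ℂ} (h : IsNewtonPuiseux F E α) :
    ∃ d : ℕ, 0 < d ∧ ∃ u, ∀ m : ℕ, 0 < m → FactorsWith F u E α (d * m) := by
  obtain ⟨hα, u, hu, hu0, d, hd, hden, heq⟩ := h
  refine ⟨d, hd, u, fun m hm =>
    ⟨fun i => (hα i).1.convergesWith ((hden i).mul hm), fun i => (hα i).2, hu, hu0, ?_⟩⟩
  have hpow : Tendsto (fun w : ℂ × ℂ => (w.1, w.2 ^ m)) (𝓝 (0, 0)) (𝓝 (0, 0)) := by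
    have hc : Continuous fun w : ℂ × ℂ => (w.1, w.2 ^ m) := by fun_prop
    have := hc.tendsto ((0, 0) : ℂ × ℂ)
    simpa [zero_pow hm.ne'] using this
  filter_upwards [hpow.eventually heq] with w hw
  rw [mul_comm d m, pow_mul, hw, mul_comm m d]
  congr 1
  exact Finset.prod_congr rfl fun i _ => by rw [param_mul (hden i) hm]

/-! ### Orders and logarithmic derivatives along an arc -/

section Along

variable {F u : ℂ × ℂ → ℂ} {E n D : ℕ} {α : Fin n → HahnSeries ℚ ℂ} {ξ : HahnSeries ℚ ℂ}
  {m : Fin n → ℕ}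

lemma exists_difference_factor (hα : ∀ i, ConvergesWith (α i) D) (hξ : ConvergesWith ξ D)
    (hm : ∀ i, contact ξ (α i) = (((m i : ℚ) / (D : ℚ) : ℚ) : WithTop ℚ)) (i : Fin n) :
    ∃ Q : ℂ → ℂ, AnalyticAt ℂ Q 0 ∧ Q 0 ≠ 0 ∧ Q 0 = (ξ - α i).coeff ((m i : ℚ) / (D : ℚ)) ∧
      ∀ᶠ t in 𝓝 (0 : ℂ), param ξ D t - param (α i) D t = t ^ m i * Q t := by
  obtain ⟨Q, hQ, hQ0, hQe⟩ := (hξ.sub (hα i)).exists_factor (hm i).ge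
  refine ⟨Q, hQ, ?_, hQ0, ?_⟩
  · rw [hQ0]
    exact HahnSeries.coeff_orderTop_ne (hm i)
  · filter_upwards [hQe, eventually_param_sub hξ (hα i)] with t h1 h2
    rw [← h2, h1]

/-- The order of `F` along an arc is the sum of the orders of its factors. -/
lemma FactorsWith.order_along (hF : FactorsWith F u E α D) (hFa : AnalyticAt ℂ F (0, 0))
    (hξ : ConvergesWith ξ D) (hpos : 0 < ξ.orderTop)
    (hm : ∀ i, contact ξ (α i) = (((m i : ℚ) / (D : ℚ) : ℚ) : WithTop ℚ)) :
    analyticOrderAt (fun t : ℂ => F (param ξ D t, t ^ D)) 0 = (D * E + ∑ i, m i : ℕ) := by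
  choose Q hQ hQ0 _ hQe using exists_difference_factor hF.conv hξ hm
  rw [(hξ.analyticAt_comp hpos hFa).analyticOrderAt_eq_natCast]
  refine ⟨fun t => u (param ξ D t, t ^ D) * ∏ i, Q i t, ?_, ?_, ?_⟩
  · exact (hξ.analyticAt_comp hpos hF.analyticAt).mul
      (Finset.analyticAt_fun_prod _ fun i _ => hQ i)
  · beta_reduce
    rw [curve_zero hξ.1.1 hpos]
    exact mul_ne_zero hF.ne_zero (Finset.prod_ne_zero_iff.2 fun i _ => hQ0 i)
  -- The factorisation is stated in the coordinates (x, t) with y = t^D, so it is pulled back along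
  -- (ξ, t) and not (ξ, t^D).
  · have hc : Tendsto (fun t : ℂ => (param ξ D t, t)) (𝓝 0) (𝓝 (0, 0)) := by
      have := (hξ.analyticAt_param.continuousAt.prodMk continuousAt_id).tendsto
      simpa [param_zero_of_pos hpos] using this
    filter_upwards [hc.eventually hF.eq, eventually_all.2 hQe] with t h1 h2
    rw [h1, Finset.prod_congr rfl fun i _ => h2 i, Finset.prod_mul_distrib,
      Finset.prod_pow_eq_pow_sum, sub_zero, smul_eq_mul, pow_add, pow_mul]
    ring

/-- The quotient is t^(H - m i)/Q with Q nonvanishing at 0, so only a root whose contact order is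
the full H/D contributes to the limit. -/
lemma tendsto_pow_div (hα : ∀ i, ConvergesWith (α i) D) (hξ : ConvergesWith ξ D)
    (hm : ∀ i, contact ξ (α i) = (((m i : ℚ) / (D : ℚ) : ℚ) : WithTop ℚ)) {H : ℕ} (i : Fin n)
    (hH : m i ≤ H) :
    Tendsto (fun t => t ^ H / (param ξ D t - param (α i) D t)) (𝓝[≠] 0)
      (𝓝 (if m i = H then ((ξ - α i).coeff ((H : ℚ) / (D : ℚ)))⁻¹ else 0)) := by
  obtain ⟨Q, hQ, hQ0, hQc, hQe⟩ := exists_difference_factor hα hξ hm i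
  have hlim : Tendsto (fun t : ℂ => t ^ (H - m i) / Q t) (𝓝[≠] 0)
      (𝓝 (0 ^ (H - m i) / Q 0)) :=
    (((continuous_pow _).continuousAt.div hQ.continuousAt hQ0).tendsto).mono_left
      nhdsWithin_le_nhds
  have hval : (if m i = H then ((ξ - α i).coeff ((H : ℚ) / (D : ℚ)))⁻¹ else 0)
      = 0 ^ (H - m i) / Q 0 := by
    split_ifs with h
    · subst h
      simp [hQc]
    · rw [zero_pow (by omega), zero_div]
  rw [hval]
  refine hlim.congr' ?_
  filter_upwards [hQe.filter_mono nhdsWithin_le_nhds, self_mem_nhdsWithin] with t h1 h2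
  have ht : (t : ℂ) ≠ 0 := h2
  rw [h1, ← Nat.sub_add_cancel hH, pow_add, Nat.add_sub_cancel, mul_comm (t ^ m i),
    mul_div_mul_right _ _ (pow_ne_zero _ ht)]

lemma deriv_fst_eq_fderiv {G : ℂ × ℂ → ℂ} {w : ℂ × ℂ} (h : DifferentiableAt ℂ G w) :
    HasDerivAt (fun x => G (x, w.2)) (fderiv ℂ G w (1, 0)) w.1 := by
  have h1 : HasDerivAt (fun x : ℂ => (x, w.2)) ((1 : ℂ), (0 : ℂ)) w.1 :=
    (hasDerivAt_id _).prodMk (hasDerivAt_const _ _)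
  exact HasFDerivAt.comp_hasDerivAt (l := G) w.1 h.hasFDerivAt h1

lemma deriv_snd_eq_fderiv {G : ℂ × ℂ → ℂ} {w : ℂ × ℂ} (h : DifferentiableAt ℂ G w) :
    HasDerivAt (fun y => G (w.1, y)) (fderiv ℂ G w (0, 1)) w.2 := by
  have h1 : HasDerivAt (fun y : ℂ => (w.1, y)) ((0 : ℂ), (1 : ℂ)) w.2 :=
    (hasDerivAt_const _ _).prodMk (hasDerivAt_id _)
  exact HasFDerivAt.comp_hasDerivAt (l := G) w.2 h.hasFDerivAt h1

/-- `y ^ h * F_x / F` tends, along an arc, to the sum of the inverses of the leading coefficients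
of the differences with the roots of `F` of contact order `h`. -/
lemma FactorsWith.tendsto_logDeriv (hF : FactorsWith F u E α D)
    (hξ : ConvergesWith ξ D) (hpos : 0 < ξ.orderTop)
    (hm : ∀ i, contact ξ (α i) = (((m i : ℚ) / (D : ℚ) : ℚ) : WithTop ℚ)) {H : ℕ} (hH0 : 0 < H)
    (hH : ∀ i, m i ≤ H) :
    Tendsto (fun t => t ^ H * (deriv (fun x => F (x, t ^ D)) (param ξ D t) /
        F (param ξ D t, t ^ D))) (𝓝[≠] 0)
      (𝓝 (∑ i, if m i = H then ((ξ - α i).coeff ((H : ℚ) / (D : ℚ)))⁻¹ else 0)) := by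
  have hc : Tendsto (fun t : ℂ => (param ξ D t, t)) (𝓝 0) (𝓝 (0, 0)) := by
    have := (hξ.analyticAt_param.continuousAt.prodMk continuousAt_id).tendsto
    simpa [param_zero_of_pos hpos] using this
  have hcD := hξ.tendsto_curve hpos
  have hroots := tendsto_finsetSum Finset.univ
    fun i _ => tendsto_pow_div hF.conv hξ hm i (hH i)
  -- The logarithmic derivative of the unit is bounded, so t^H kills it; this is where H > 0 enters.
  have hu1 : Tendsto (fun t : ℂ => t ^ H * (fderiv ℂ u (param ξ D t, t ^ D) (1, 0) /
      u (param ξ D t, t ^ D))) (𝓝[≠] 0) (𝓝 0) := by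
    have ha : Tendsto (fun t : ℂ => fderiv ℂ u (param ξ D t, t ^ D) (1, 0)) (𝓝 0)
        (𝓝 (fderiv ℂ u (0, 0) (1, 0))) :=
      ((hF.analyticAt.fderiv.continuousAt.clm_apply continuousAt_const).tendsto).comp hcD
    have hb : Tendsto (fun t : ℂ => u (param ξ D t, t ^ D)) (𝓝 0) (𝓝 (u (0, 0))) :=
      hF.analyticAt.continuousAt.tendsto.comp hcD
    have hp : Tendsto (fun t : ℂ => t ^ H) (𝓝 0) (𝓝 0) := by
      have := (continuous_pow H).tendsto (0 : ℂ)
      rwa [zero_pow hH0.ne'] at this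
    have := hp.mul (ha.div hb hF.ne_zero)
    rw [zero_mul] at this
    exact this.mono_left nhdsWithin_le_nhds
  have hsum := hu1.add hroots
  rw [zero_add] at hsum
  refine hsum.congr' ?_
  choose Q hQ hQ0 _ hQe using exists_difference_factor hF.conv hξ hm
  have hune : ∀ᶠ t in 𝓝 (0 : ℂ), u (param ξ D t, t ^ D) ≠ 0 :=
    hcD.eventually (hF.analyticAt.continuousAt.eventually_ne hF.ne_zero)
  have hud : ∀ᶠ t in 𝓝 (0 : ℂ), AnalyticAt ℂ u (param ξ D t, t ^ D) :=
    hcD.eventually hF.analyticAt.eventually_analyticAt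
  have hQne : ∀ᶠ t in 𝓝 (0 : ℂ), ∀ i, Q i t ≠ 0 :=
    eventually_all.2 fun i => (hQ i).continuousAt.eventually_ne (hQ0 i)
  filter_upwards [(hc.eventually hF.eq.eventually_nhds).filter_mono nhdsWithin_le_nhds,
    hune.filter_mono nhdsWithin_le_nhds, hud.filter_mono nhdsWithin_le_nhds,
    hQne.filter_mono nhdsWithin_le_nhds,
    (eventually_all.2 hQe).filter_mono nhdsWithin_le_nhds, self_mem_nhdsWithin]
    with t heq hu0 hua hQt hQt' ht
  have ht0 : t ≠ 0 := ht
  have hline : Tendsto (fun x : ℂ => (x, t)) (𝓝 (param ξ D t)) (𝓝 (param ξ D t, t)) :=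
    (Continuous.prodMk continuous_id continuous_const).tendsto _
  have heq' : (fun x => F (x, t ^ D)) =ᶠ[𝓝 (param ξ D t)]
      fun x => u (x, t ^ D) * (t ^ D) ^ E * ∏ i, (x - param (α i) D t) :=
    hline.eventually heq
  have hdiff : ∀ i, param ξ D t - param (α i) D t ≠ 0 := fun i => by
    rw [hQt' i]
    exact mul_ne_zero (pow_ne_zero _ ht0) (hQt i)
  have hux := deriv_fst_eq_fderiv hua.differentiableAt
  have hlog : deriv (fun x => F (x, t ^ D)) (param ξ D t) / F (param ξ D t, t ^ D) =
      fderiv ℂ u (param ξ D t, t ^ D) (1, 0) / u (param ξ D t, t ^ D) +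
        ∑ i, 1 / (param ξ D t - param (α i) D t) := by
    rw [heq'.deriv_eq, show F (param ξ D t, t ^ D) = _ from heq'.self_of_nhds]
    -- Here y is fixed and nonzero: the factor y^E is a constant and drops out of the logarithmic
    -- derivative in x.
    have hE : (t ^ D) ^ E ≠ 0 := pow_ne_zero _ (pow_ne_zero _ ht0)
    have h1 := logDeriv_mul (f := fun x => u (x, t ^ D) * (t ^ D) ^ E)
      (g := fun x => ∏ i, (x - param (α i) D t)) (param ξ D t) (mul_ne_zero hu0 hE)
      (Finset.prod_ne_zero_iff.2 fun i _ => hdiff i)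
      (hux.differentiableAt.mul_const _) (by fun_prop)
    rw [logDeriv_mul_const _ _ hE, logDeriv_apply, logDeriv_apply, hux.deriv] at h1
    have h2 := logDeriv_prod (s := Finset.univ)
      (f := fun (i : Fin n) (x : ℂ) => x - param (α i) D t) (x := param ξ D t)
      (fun i _ => hdiff i) (fun i _ => by fun_prop)
    rw [h1, h2]
    congr 1
    refine Finset.sum_congr rfl fun i _ => ?_
    rw [logDeriv_apply]
    simp
  rw [hlog, mul_add, Finset.mul_sum]
  simp only [mul_one_div]

/-- `t φ' / φ` tends to the order of `φ`. -/
lemma tendsto_mul_logDeriv {φ : ℂ → ℂ} (hφ : AnalyticAt ℂ φ 0) {k : ℕ}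
    (hk : analyticOrderAt φ 0 = k) :
    Tendsto (fun t => t * (deriv φ t / φ t)) (𝓝[≠] 0) (𝓝 k) := by
  obtain ⟨g, hg, hg0, hge⟩ := hφ.analyticOrderAt_eq_natCast.1 hk
  have hlim : Tendsto (fun t => (k : ℂ) + t * (deriv g t / g t)) (𝓝[≠] 0) (𝓝 k) := by
    have h1 : ContinuousAt (fun t => (k : ℂ) + t * (deriv g t / g t)) 0 :=
      continuousAt_const.add (continuousAt_id.mul
        (hg.deriv.continuousAt.div hg.continuousAt hg0))
    have := h1.tendsto
    simp only [zero_mul, add_zero] at this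
    exact this.mono_left nhdsWithin_le_nhds
  refine hlim.congr' ?_
  filter_upwards [hge.eventually_nhds.filter_mono nhdsWithin_le_nhds,
    (hg.continuousAt.eventually_ne hg0).filter_mono nhdsWithin_le_nhds,
    hg.eventually_analyticAt.filter_mono nhdsWithin_le_nhds, self_mem_nhdsWithin]
    with t heq hgt hga ht
  have ht0 : t ≠ 0 := ht
  have heq' : φ =ᶠ[𝓝 t] fun s => s ^ k * g s := by
    filter_upwards [heq] with s hs
    rw [hs, sub_zero, smul_eq_mul]
  rw [heq'.deriv_eq, heq'.self_of_nhds, ← logDeriv_apply (fun s => s ^ k * g s),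
    logDeriv_mul (f := fun s => s ^ k) t (pow_ne_zero _ ht0) hgt (by fun_prop) hga.differentiableAt]
  simp only [logDeriv_apply, deriv_pow_field]
  rcases Nat.eq_zero_or_pos k with rfl | hk0
  · simp
  · rw [mul_add]
    congr 1
    obtain ⟨l, rfl⟩ : ∃ l, k = l + 1 := ⟨k - 1, by omega⟩
    rw [Nat.add_sub_cancel, pow_succ]
    field_simp

end Along

/-- Along a curve on which the Jacobian of `(f, g)` vanishes, `(f ∘ ξ)' g_x = (g ∘ ξ)' f_x`. -/
lemma eventually_deriv_mul_eq {f g : ℂ × ℂ → ℂ} (hf : AnalyticAt ℂ f (0, 0))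
    (hg : AnalyticAt ℂ g (0, 0)) {ξ : HahnSeries ℚ ℂ} {D : ℕ} (hξ : ConvergesWith ξ D)
    (hpos : 0 < ξ.orderTop)
    (hJ : ∀ᶠ t in 𝓝 (0 : ℂ), jac f g (param ξ D t, t ^ D) = 0) :
    ∀ᶠ t in 𝓝 (0 : ℂ),
      deriv (fun s => f (param ξ D s, s ^ D)) t * deriv (fun x => g (x, t ^ D)) (param ξ D t) =
      deriv (fun s => g (param ξ D s, s ^ D)) t * deriv (fun x => f (x, t ^ D)) (param ξ D t) := by
  have hcD := hξ.tendsto_curve hpos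
  have key : ∀ {G : ℂ × ℂ → ℂ} {t : ℂ}, AnalyticAt ℂ G (param ξ D t, t ^ D) →
      AnalyticAt ℂ (param ξ D) t →
      deriv (fun s => G (param ξ D s, s ^ D)) t =
        deriv (fun x => G (x, t ^ D)) (param ξ D t) * deriv (param ξ D) t +
        deriv (fun y => G (param ξ D t, y)) (t ^ D) * deriv (fun s : ℂ => s ^ D) t := by
    intro G t hG ht
    have h1 : HasDerivAt (fun s : ℂ => (param ξ D s, s ^ D))
        (deriv (param ξ D) t, deriv (fun s : ℂ => s ^ D) t) t :=
      ht.differentiableAt.hasDerivAt.prodMk (differentiableAt_id.pow D).hasDerivAt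
    have h2 := HasFDerivAt.comp_hasDerivAt (l := G) t hG.differentiableAt.hasFDerivAt h1
    have h3 := h2.deriv
    change deriv (fun s => G (param ξ D s, s ^ D)) t = _ at h3
    rw [h3, (deriv_fst_eq_fderiv hG.differentiableAt).deriv,
      (deriv_snd_eq_fderiv hG.differentiableAt).deriv]
    have h4 : (deriv (param ξ D) t, deriv (fun s : ℂ => s ^ D) t) =
        deriv (param ξ D) t • ((1 : ℂ), (0 : ℂ)) +
          deriv (fun s : ℂ => s ^ D) t • ((0 : ℂ), (1 : ℂ)) := by
      ext <;> simp
    rw [h4, map_add, map_smul, map_smul, smul_eq_mul, smul_eq_mul]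
    ring
  filter_upwards [hJ, hcD.eventually hf.eventually_analyticAt,
    hcD.eventually hg.eventually_analyticAt, hξ.analyticAt_param.eventually_analyticAt]
    with t hJt hft hgt hξt
  rw [key hft hξt, key hgt hξt]
  simp only [jac] at hJt
  -- The terms containing the derivative of ξ(t^D) cancel; what remains is the derivative of t^D
  -- times the Jacobian.
  linear_combination deriv (fun s : ℂ => s ^ D) t * hJt

/-! ### The tree -/

section Contact

variable {ξ η ζ : HahnSeries ℚ ℂ} {o : WithTop ℚ}

lemma le_contact_trans (h : o ≤ contact ξ η) (h' : o ≤ contact η ζ) : o ≤ contact ξ ζ := by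
  have := HahnSeries.min_orderTop_le_orderTop_add (x := ξ - η) (y := η - ζ)
  rw [sub_add_sub_cancel] at this
  exact (le_min h h').trans this

lemma lt_contact_trans (h : o < contact ξ η) (h' : o < contact η ζ) : o < contact ξ ζ := by
  have := HahnSeries.min_orderTop_le_orderTop_add (x := ξ - η) (y := η - ζ)
  rw [sub_add_sub_cancel] at this
  exact (lt_min h h').trans_le this

/-- Isosceles principle for the ultrametric: passing from η to an arc closer to η than ζ is does not
change the contact with ζ. -/
lemma contact_eq_of_lt (h : contact η ζ < contact ξ η) : contact ξ ζ = contact η ζ := by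
  refine le_antisymm (not_lt.1 fun hlt => ?_) (le_contact_trans h.le le_rfl)
  exact lt_irrefl _ (lt_contact_trans (contact_comm ξ η ▸ h) hlt)

lemma contact_self (ξ : HahnSeries ℚ ℂ) : contact ξ ξ = ⊤ := by simp [contact]

end Contact

variable {p q : ℕ} {α : Fin p → HahnSeries ℚ ℂ} {β : Fin q → HahnSeries ℚ ℂ} {B : Bar p q}

lemma mem_trunk {j k : Fin p ⊕ Fin q} :
    j ∈ trunk α β B k ↔ j ∈ B.roots ∧
      (B.height : WithTop ℚ) < contact (root α β j) (root α β k) := by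
  simp [trunk]

lemma mem_trunk_self {k : Fin p ⊕ Fin q} (hk : k ∈ B.roots) : k ∈ trunk α β B k :=
  mem_trunk.2 ⟨hk, by rw [contact_self]; exact WithTop.coe_lt_top _⟩

/-- The minimum `h` is attained by two roots of one trunk; both have contact above the height of `B`
with root `k`, hence with each other. -/
lemma height_lt_postbar {k : Fin p ⊕ Fin q} {h : ℚ}
    (hh : IsLeast {o : WithTop ℚ | ∃ i ∈ trunk α β B k, ∃ j ∈ trunk α β B k,
      o = contact (root α β i) (root α β j)} (h : WithTop ℚ)) : B.height < h := by
  obtain ⟨i, hi, j, hj, hij⟩ := hh.1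
  have := lt_contact_trans (mem_trunk.1 hi).2 (contact_comm (root α β j) _ ▸ (mem_trunk.1 hj).2)
  rw [← hij] at this
  exact WithTop.coe_lt_coe.1 this

lemma IsBar.height_nonneg (hB : IsBar α β B) : 0 ≤ B.height := by
  induction hB with
  | ground => exact le_rfl
  | postbar B k h _ _ hh ih => exact ih.trans (height_lt_postbar hh).le

/-- A root which does not belong to `B` separates from the roots on `B` below the height of `B`. -/
lemma IsBar.contact_lt_height (hB : IsBar α β B) {j k : Fin p ⊕ Fin q} (hj : j ∉ B.roots)
    (hk : k ∈ B.roots) : contact (root α β k) (root α β j) < B.height := by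
  induction hB generalizing j k with
  | ground => exact absurd (Finset.mem_univ j) hj
  | postbar B k₀ h _ hk₀ hh ih =>
    have hlt : (B.height : WithTop ℚ) < h := WithTop.coe_lt_coe.2 (height_lt_postbar hh)
    have h0 : (h : WithTop ℚ) ≤ contact (root α β k₀) (root α β k) :=
      hh.2 ⟨k₀, mem_trunk_self hk₀, k, hk, rfl⟩
    -- A root outside the new bar either lies on `B` but in another trunk, or is already off `B`,
    -- where the induction hypothesis applies.
    have h1 : contact (root α β k₀) (root α β j) < h := by
      by_cases hjB : j ∈ B.roots
      · have : ¬ (B.height : WithTop ℚ) < contact (root α β j) (root α β k₀) :=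
          fun hc => hj (mem_trunk.2 ⟨hjB, hc⟩)
        rw [contact_comm]
        exact (not_lt.1 this).trans_lt hlt
      · exact (ih hjB hk₀).trans hlt
    exact not_le.1 fun hc => not_lt.2 (le_contact_trans h0 hc) h1

/-- A bar is the ground bar, or it has positive height and comes from a root. -/
lemma IsBar.ground_or_pos (hB : IsBar α β B) :
    (B = ⟨0, 0, Finset.univ⟩) ∨ (0 < B.height ∧ ∃ k ∈ B.roots,
      B.base = HahnSeries.truncLT B.height (root α β k) ∧
      (∀ i ∈ B.roots, (B.height : WithTop ℚ) ≤ contact (root α β k) (root α β i)) ∧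
      ∃ i j, contact (root α β i) (root α β j) = B.height) := by
  cases hB with
  | ground => exact Or.inl rfl
  | postbar B k h hB hk hh =>
    refine Or.inr ⟨hB.height_nonneg.trans_lt (height_lt_postbar hh), k, mem_trunk_self hk, rfl,
      fun i hi => hh.2 ⟨k, mem_trunk_self hk, i, hi, rfl⟩, ?_⟩
    obtain ⟨i, -, j, -, hij⟩ := hh.1
    exact ⟨i, j, hij.symm⟩

/-! ### Climbing over a bar -/

/-- Since λ_B is a truncation of root `k`, the exponents below h(B) give agreement with that root
and the exponent h(B) itself gives `a`. -/
lemma climbsAt_iff {k : Fin p ⊕ Fin q} (hbase : B.base = HahnSeries.truncLT B.height (root α β k))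
    {ξ : HahnSeries ℚ ℂ} {a : ℂ} :
    ClimbsAt ξ B a ↔ (B.height : WithTop ℚ) ≤ contact ξ (root α β k) ∧ ξ.coeff B.height = a := by
  rw [ClimbsAt, lt_orderTop_iff, contact, le_orderTop_iff]
  simp only [arcAt, hbase, HahnSeries.coeff_sub, HahnSeries.coeff_add, HahnSeries.coeff_truncLT]
  constructor
  · intro h
    refine ⟨fun e he => ?_, ?_⟩
    · simpa [he, HahnSeries.coeff_single_of_ne he.ne] using h e he.le
    · simpa [sub_eq_zero] using h _ le_rfl
  · rintro ⟨h1, rfl⟩ e he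
    rcases he.lt_or_eq with he | rfl
    · simpa [he, HahnSeries.coeff_single_of_ne he.ne] using h1 e he
    · simp

lemma climbsAt_arcAt (B : Bar p q) (z : ℂ) : ClimbsAt (arcAt B z) B z := by
  simp [ClimbsAt]

lemma eventually_notMem_finset (s : Finset ℂ) : ∀ᶠ z in 𝓝[≠] (0 : ℂ), z ∉ s := by
  have : ∀ᶠ z in 𝓝[≠] (0 : ℂ), ∀ c ∈ s, z ≠ c := by
    rw [eventually_all_finset]
    intro c _
    by_cases hc : c = 0
    · subst hc
      exact self_mem_nhdsWithin
    · exact (continuousAt_id.eventually_ne (Ne.symm hc)).filter_mono nhdsWithin_le_nhds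
  filter_upwards [this] with z hz hzs using hz z hzs rfl

/-- The contact orders of an arc climbing over `B` away from the points on `B` do not depend on
the arc. -/
lemma IsBar.exists_contact_eq (hB : IsBar α β B) {D H : ℕ}
    (hden : ∀ i, HasDen (root α β i) D) (hH : B.height = (H : ℚ) / (D : ℚ))
    {k : Fin p ⊕ Fin q} (hk : k ∈ B.roots)
    (hbase : B.base = HahnSeries.truncLT B.height (root α β k))
    (hroots : ∀ i ∈ B.roots, (B.height : WithTop ℚ) ≤ contact (root α β k) (root α β i)) :
    ∃ m : Fin p ⊕ Fin q → ℕ, (∀ i, m i ≤ H) ∧ (∀ i, m i = H ↔ i ∈ B.roots) ∧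
      ∀ (ξ : HahnSeries ℚ ℂ) (z : ℂ), ClimbsAt ξ B z → z ∉ points α β B →
        ∀ i, contact ξ (root α β i) = (((m i : ℚ) / (D : ℚ) : ℚ) : WithTop ℚ) := by
  classical
  have hD : (0 : ℚ) < D := by exact_mod_cast (hden k).1
  have hout : ∀ i, i ∉ B.roots → ∃ n : ℕ,
      contact (root α β k) (root α β i) = (((n : ℚ) / (D : ℚ) : ℚ) : WithTop ℚ) ∧ n < H := by
    intro i hi
    have hlt := hB.contact_lt_height hi hk
    obtain ⟨n, hn⟩ := ((hden k).sub (hden i)).orderTop_eq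
      (fun h0 => by rw [contact, h0, HahnSeries.orderTop_zero] at hlt; exact not_top_lt hlt)
    refine ⟨n, hn, ?_⟩
    rw [contact, hn, hH, WithTop.coe_lt_coe, div_lt_div_iff_of_pos_right hD] at hlt
    exact_mod_cast hlt
  choose n hn hnH using hout
  refine ⟨fun i => if hi : i ∈ B.roots then H else n i hi, fun i => ?_, fun i => ?_, ?_⟩
  · dsimp only
    split_ifs with hi
    · exact le_rfl
    · exact (hnH i hi).le
  · dsimp only
    split_ifs with hi
    · simp [hi]
    · simpa [hi] using (hnH i hi).ne
  · intro ξ z hξ hz i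
    obtain ⟨h1, h2⟩ := (climbsAt_iff hbase).1 hξ
    dsimp only
    split_ifs with hi
    · rw [← hH]
      -- For a root on `B`, the bound from below is ultrametric. The bound from above holds because
      -- the coefficient of the difference at h(B) is `z` minus a point on `B`.
      refine le_antisymm ?_ (le_contact_trans h1 (hroots i hi))
      refine HahnSeries.orderTop_le_of_coeff_ne_zero ?_
      rw [HahnSeries.coeff_sub, h2, sub_ne_zero]
      rintro rfl
      exact hz (Finset.mem_image_of_mem _ hi)
    · rw [← hn i hi]
      exact contact_eq_of_lt ((hB.contact_lt_height hi hk).trans_le h1)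

/-- The sum over the points on `B` of the multiplicities divided by `z - c`, as a sum over the
roots on `B`. -/
lemma sum_mult_div {k : Fin p ⊕ Fin q}
    (hbase : B.base = HahnSeries.truncLT B.height (root α β k))
    (hroots : ∀ i ∈ B.roots, (B.height : WithTop ℚ) ≤ contact (root α β k) (root α β i))
    {n : ℕ} (ι : Fin n → Fin p ⊕ Fin q) (z : ℂ)
    [∀ c, DecidablePred fun i => ι i ∈ B.roots ∧ ClimbsAt (root α β (ι i)) B c] :
    ∑ c ∈ points α β B, ((Finset.univ.filter fun i : Fin n =>
        ι i ∈ B.roots ∧ ClimbsAt (root α β (ι i)) B c).card : ℂ) / (z - c) =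
      ∑ i, if ι i ∈ B.roots then (z - (root α β (ι i)).coeff B.height)⁻¹ else 0 := by
  simp only [Finset.card_filter, Nat.cast_sum, Finset.sum_div]
  rw [Finset.sum_comm]
  refine Finset.sum_congr rfl fun i _ => ?_
  split_ifs with hi
  -- A root on `B` climbs at exactly one point, so it is counted in a single summand.
  · have hcl : ∀ c, ClimbsAt (root α β (ι i)) B c ↔ (root α β (ι i)).coeff B.height = c :=
      fun c => by
        rw [climbsAt_iff hbase, contact_comm]
        exact and_iff_right (hroots _ hi)
    rw [Finset.sum_eq_single ((root α β (ι i)).coeff B.height)]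
    · rw [if_pos ⟨hi, (hcl _).2 rfl⟩, Nat.cast_one, one_div]
    · intro c _ hc
      rw [if_neg fun h => hc ((hcl c).1 h.2).symm, Nat.cast_zero, zero_div]
    · exact fun h => absurd (Finset.mem_image_of_mem _ hi) h
  · exact Finset.sum_eq_zero fun c _ => by rw [if_neg fun h => hi h.1, Nat.cast_zero, zero_div]

/-! ### Generic orders on a bar and vanishing of the meromorphic function -/

lemma nu_eq {F : ℂ × ℂ → ℂ} (hF : AnalyticAt ℂ F (0, 0)) {D : ℕ} {v : ℚ}
    (hconv : ∀ z, ConvergesWith (arcAt B z) D) (hpos : ∀ z, 0 < (arcAt B z).orderTop)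
    (hv : ∀ᶠ z in 𝓝[≠] (0 : ℂ), HasOrderAlong F (arcAt B z) v) : nu F B = v := by
  have h : ∃ v : ℚ, ∀ᶠ z in 𝓝[≠] (0 : ℂ), HasOrderAlong F (arcAt B z) v := ⟨v, hv⟩
  rw [nu, dif_pos h]
  -- Both values are attained along a common arc, where the order is unique.
  obtain ⟨z, h1, h2⟩ := (h.choose_spec.and hv).exists
  exact h1.unique (hconv z) (hpos z) hF h2

/-- The generic order on a bar, in terms of the contact orders `m i / D`. -/
lemma FactorsWith.nu_eq {F u : ℂ × ℂ → ℂ} {E n D : ℕ} {η : Fin n → HahnSeries ℚ ℂ}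
    (hF : FactorsWith F u E η D) (hFa : AnalyticAt ℂ F (0, 0))
    (hconv : ∀ z, ConvergesWith (arcAt B z) D) (hpos : ∀ z, 0 < (arcAt B z).orderTop)
    {m : Fin n → ℕ} (hm : ∀ z ∉ points α β B, ∀ i,
      contact (arcAt B z) (η i) = (((m i : ℚ) / (D : ℚ) : ℚ) : WithTop ℚ)) :
    nu F B = ((D * E + ∑ i, m i : ℕ) : ℚ) / (D : ℚ) := by
  refine PolarTree.nu_eq hFa hconv hpos ?_
  filter_upwards [eventually_notMem_finset (points α β B)] with z hz
  exact ⟨D, (hconv z).1, _, hF.order_along hFa (hconv z) (hpos z) (hm z hz), rfl⟩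

/-- The function `M_B` vanishes at a point, not on the tree, at which a polar root climbs over a
bar of positive height. -/
lemma meroFun_eq_zero {f g : ℂ × ℂ → ℂ} (hf : AnalyticAt ℂ f (0, 0)) (hg : AnalyticAt ℂ g (0, 0))
    {E₁ E₂ : ℕ} (hα : IsNewtonPuiseux f E₁ α) (hβ : IsNewtonPuiseux g E₂ β) (hB : IsBar α β B)
    {γ : HahnSeries ℚ ℂ} (hγ : IsPolarRoot f g γ) {z : ℂ} (hz : ClimbsAt γ B z)
    (hzp : z ∉ points α β B) (hh : 0 < B.height) {k : Fin p ⊕ Fin q} (hk : k ∈ B.roots)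
    (hbase : B.base = HahnSeries.truncLT B.height (root α β k))
    (hroots : ∀ i ∈ B.roots, (B.height : WithTop ℚ) ≤ contact (root α β k) (root α β i))
    {i₀ j₀ : Fin p ⊕ Fin q} (hij : contact (root α β i₀) (root α β j₀) = B.height) :
    meroFun f g α β B z = 0 := by
  classical
  obtain ⟨hγarc, hγpos, ⟨d, hd, hJ⟩, -⟩ := hγ
  obtain ⟨d₁, hd₁, u₁, hu₁⟩ := hα.exists_factorsWith
  obtain ⟨d₂, hd₂, u₂, hu₂⟩ := hβ.exists_factorsWith
  -- A common denominator for γ and for the factorisations of f and g.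
  obtain ⟨D, hDdef⟩ : ∃ D, D = d * (d₁ * d₂) := ⟨_, rfl⟩
  have hF : FactorsWith f u₁ E₁ α D := by
    have := hu₁ (d * d₂) (Nat.mul_pos hd.1 hd₂)
    rwa [show d₁ * (d * d₂) = D by rw [hDdef]; ring] at this
  have hG : FactorsWith g u₂ E₂ β D := by
    have := hu₂ (d * d₁) (Nat.mul_pos hd.1 hd₁)
    rwa [show d₂ * (d * d₁) = D by rw [hDdef]; ring] at this
  have hJ' := eventually_vanishes_mul hd (Nat.mul_pos hd₁ hd₂) hJ
  have hγD : ConvergesWith γ D := by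
    rw [hDdef]
    exact hγarc.convergesWith (hd.mul (Nat.mul_pos hd₁ hd₂))
  rw [← hDdef] at hJ'
  have hconv : ∀ i, ConvergesWith (root α β i) D := by
    rintro (i | j)
    · exact hF.conv i
    · exact hG.conv j
  have hposr : ∀ i, 0 < (root α β i).orderTop := by
    rintro (i | j)
    · exact hF.pos i
    · exact hG.pos j
  have hD0 : 0 < D := hγD.1.1
  have hD : (0 : ℚ) < D := by exact_mod_cast hD0
  -- The height is a contact order of two roots, so `D` is a denominator for it as well.
  obtain ⟨H, hH⟩ := ((hconv i₀).1.sub (hconv j₀).1).orderTop_eq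
    (fun h0 => by rw [contact, h0, HahnSeries.orderTop_zero] at hij; exact WithTop.top_ne_coe hij)
  have hH : B.height = (H : ℚ) / (D : ℚ) := by
    rw [contact, hH] at hij
    exact (WithTop.coe_inj.1 hij).symm
  have hH0 : 0 < H := by
    rw [hH, div_pos_iff_of_pos_right hD] at hh
    exact_mod_cast hh
  obtain ⟨m, hmH, hmiff, hm⟩ :=
    hB.exists_contact_eq (fun i => (hconv i).1) hH hk hbase hroots
  have haconv : ∀ a, ConvergesWith (arcAt B a) D := fun a => by
    rw [arcAt, hbase]
    refine ((hconv k).truncLT _).add ?_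
    rw [hH]
    exact convergesWith_single hD0 H a
  have hapos : ∀ a, 0 < (arcAt B a).orderTop := fun a => by
    change ((0 : ℚ) : WithTop ℚ) < _
    rw [lt_orderTop_iff]
    intro e he
    have h1 : e < B.height := he.trans_lt hh
    have h2 : (root α β k).coeff e = 0 := lt_orderTop_iff.1 (hposr k) e he
    rw [arcAt, hbase, HahnSeries.coeff_add, HahnSeries.coeff_truncLT, if_pos h1, h2,
      HahnSeries.coeff_single_of_ne h1.ne, add_zero]
  have hnf := hF.nu_eq hf haconv hapos (α := α) (β := β) (m := fun i => m (Sum.inl i))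
    fun a ha i => hm _ a (climbsAt_arcAt B a) ha (Sum.inl i)
  have hng := hG.nu_eq hg haconv hapos (α := α) (β := β) (m := fun j => m (Sum.inr j))
    fun a ha j => hm _ a (climbsAt_arcAt B a) ha (Sum.inr j)
  have hmf : ∀ i, contact γ (α i) = (((m (Sum.inl i) : ℚ) / (D : ℚ) : ℚ) : WithTop ℚ) :=
    fun i => hm γ z hz hzp (Sum.inl i)
  have hmg : ∀ j, contact γ (β j) = (((m (Sum.inr j) : ℚ) / (D : ℚ) : ℚ) : WithTop ℚ) :=
    fun j => hm γ z hz hzp (Sum.inr j)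
  have hlim1 := (tendsto_mul_logDeriv (hγD.analyticAt_comp hγpos hf)
    (hF.order_along hf hγD hγpos hmf)).mul
    (hG.tendsto_logDeriv hγD hγpos hmg hH0 fun j => hmH _)
  have hlim2 := (tendsto_mul_logDeriv (hγD.analyticAt_comp hγpos hg)
    (hG.order_along hg hγD hγpos hmg)).mul
    (hF.tendsto_logDeriv hγD hγpos hmf hH0 fun i => hmH _)
  have hγz := ((climbsAt_iff hbase).1 hz).2
  have hsum : ∀ {n : ℕ} (ι : Fin n → Fin p ⊕ Fin q),
      (∑ i, if m (ι i) = H then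
          ((γ - root α β (ι i)).coeff ((H : ℚ) / (D : ℚ)))⁻¹ else 0) =
        ∑ c ∈ points α β B, ((Finset.univ.filter fun i =>
          ι i ∈ B.roots ∧ ClimbsAt (root α β (ι i)) B c).card : ℂ) / (z - c) := by
    intro n ι
    rw [sum_mult_div hbase hroots]
    refine Finset.sum_congr rfl fun i _ => ?_
    simp only [hmiff, ← hH, HahnSeries.coeff_sub, hγz]
  have hsf : (∑ i, if m (Sum.inl i) = H then
      ((γ - α i).coeff ((H : ℚ) / (D : ℚ)))⁻¹ else 0) =
        ∑ c ∈ points α β B, (multF α B c : ℂ) / (z - c) := by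
    convert hsum Sum.inl
    · rfl
    · rw [multF]
      congr!
  have hsg : (∑ j, if m (Sum.inr j) = H then
      ((γ - β j).coeff ((H : ℚ) / (D : ℚ)))⁻¹ else 0) =
        ∑ c ∈ points α β B, (multG β B c : ℂ) / (z - c) := by
    convert hsum Sum.inr
    · rfl
    · rw [multG]
      congr!
  rw [hsg] at hlim1
  rw [hsf] at hlim2
  have heq := tendsto_nhds_unique (hlim1.congr' ?_) hlim2
  · have hDc : (D : ℂ) ≠ 0 := by exact_mod_cast hD0.ne'
    have hexp : meroFun f g α β B z =
        (nu f B : ℂ) * ∑ c ∈ points α β B, (multG β B c : ℂ) / (z - c) -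
          (nu g B : ℂ) * ∑ c ∈ points α β B, (multF α B c : ℂ) / (z - c) := by
      rw [meroFun, Finset.mul_sum, Finset.mul_sum, ← Finset.sum_sub_distrib]
      refine Finset.sum_congr rfl fun c _ => ?_
      rw [delta]
      push_cast
      ring
    -- Both generic orders carry the same factor 1/D, so the equality of limits gives the
    -- cancellation.
    rw [hexp, hnf, hng, Rat.cast_div, Rat.cast_div, Rat.cast_natCast, Rat.cast_natCast,
      Rat.cast_natCast, div_mul_eq_mul_div, div_mul_eq_mul_div, heq, sub_self]
  · filter_upwards [(eventually_deriv_mul_eq hf hg hγD hγpos hJ').filter_mono nhdsWithin_le_nhds]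
      with t ht
    calc _ = t * t ^ H * (deriv (fun s => f (param γ D s, s ^ D)) t *
            deriv (fun x => g (x, t ^ D)) (param γ D t)) /
          (f (param γ D t, t ^ D) * g (param γ D t, t ^ D)) := by
          rw [mul_div_assoc, mul_div_mul_comm]; ring
      _ = _ := by rw [ht, mul_comm (f _), mul_div_assoc, mul_div_mul_comm]; ring

end PolarTree

theorem mainTheorem11 (f g : ℂ × ℂ → ℂ)
    (hf : AnalyticAt ℂ f (0, 0)) (hg : AnalyticAt ℂ g (0, 0))
    (hf0 : f (0, 0) = 0) (hg0 : g (0, 0) = 0)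
    (p q E₁ E₂ : ℕ) (α : Fin p → HahnSeries ℚ ℂ) (β : Fin q → HahnSeries ℚ ℂ)
    (hα : PolarTree.IsNewtonPuiseux f E₁ α) (hβ : PolarTree.IsNewtonPuiseux g E₂ β)
    (hsimple : Function.Injective (PolarTree.root α β))
    (B : PolarTree.Bar p q) (hB : PolarTree.IsBar α β B)
    (γ : HahnSeries ℚ ℂ) (hγ : PolarTree.IsPolarRoot f g γ)
    (z : ℂ) (hz : PolarTree.ClimbsAt γ B z) :
    z ∈ PolarTree.nonCollinearPts f g α β B ∪ PolarTree.collinearPts f g α β B ∪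
      PolarTree.meroZeros f g α β B := by
  by_cases hzp : z ∈ PolarTree.points α β B
  · by_cases hδ : PolarTree.delta f g α β B z = 0
    · exact Or.inl (Or.inr ⟨hzp, hδ⟩)
    · exact Or.inl (Or.inl ⟨hzp, hδ⟩)
  refine Or.inr ⟨fun h => hzp h.1, ?_⟩
  rcases hB.ground_or_pos with rfl | ⟨hh, k, hk, hbase, hroots, i, j, hij⟩
  · have hγ0 : γ.coeff 0 = z := by
      have := PolarTree.lt_orderTop_iff.1 hz 0 le_rfl
      simpa [PolarTree.arcAt, sub_eq_zero] using this
    have hz0 : z = 0 := hγ0 ▸ HahnSeries.coeff_eq_zero_of_lt_orderTop hγ.2.1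
    have hroot : ∀ k, (PolarTree.root α β k).coeff 0 = 0 := by
      rintro (i | j)
      · exact HahnSeries.coeff_eq_zero_of_lt_orderTop (hα.1 i).2
      · exact HahnSeries.coeff_eq_zero_of_lt_orderTop (hβ.1 j).2
    -- Every root has coefficient 0 at y^0 and z = 0, so any root would make `z` a point; hence
    -- there are no roots and the sum is empty.
    have hempty : PolarTree.points α β ⟨0, 0, Finset.univ⟩ = ∅ := by
      rw [Finset.eq_empty_iff_forall_notMem]
      intro c hc
      obtain ⟨k, hk, -⟩ := Finset.mem_image.1 hc
      exact hzp (Finset.mem_image.2 ⟨k, hk, by rw [hroot, hz0]⟩)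
    rw [PolarTree.meroFun, hempty, Finset.sum_empty]
  · exact PolarTree.meroFun_eq_zero hf hg hα hβ hB hγ hz hzp hh hk hbase hroots hij
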